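/- Let $k$ be an algebraically closed field of characteristic zero, $V$ a finite-dimensional $k$-vector space, $R,R'\subseteq V^{\otimes 3}$ subspaces, and let $A=T(V)/(R)$ and $A'=T(V)/(R')$ be the corresponding cubic algebras, graded so that $A_i$ and $A'_i$ are the images of $V^{\otimes i}$. Elements $f\in V^{\otimes 3}$ are regarded as trilinear forms on $V^*$; put $$\mathcal V(R)=\{(p_1,p_2,p_3)\in\mathbb P(V^*)^{3}\mid f(p_1,p_2,p_3)=0\ \text{for all } f\in R\},$$ and let $\pi_{12},\pi_{23}:\mathbb P(V^*)^3\to\mathbb P(V^*)^2$ be the projections to the first two and to the last two factors. One says that $A$ satisfies (G1) if $\pi_{12}$ and $\pi_{23}$ send $\mathcal V(R)$ isomorphically (as varieties) onto their images and $\pi_{12}(\mathcal V(R))=\pi_{23}(\mathcal V(R))$; then $\mathcal P(A)=(E,\sigma)$ with $E:=\pi_{12}(\mathcal V(R))$ and $\sigma:=\pi_{23}\circ\pi_{12}^{-1}:E\to E$. Varieties are understood in the classical sense, as (possibly reducible, possibly empty) sets of $k$-points with regular maps. Assume that $A$ and $A'$ satisfy (G1), with $\mathcal P(A)=(E,\sigma)$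 and $\mathcal P(A')=(E',\sigma')$. (1) If $A\cong A'$ as graded $k$-algebras, then there is an automorphism $\tau$ of the variety $\mathbb P(V^*)$ such that $\tau\times\tau$ restricts to an isomorphism $E\to E'$ and $(\tau\times\tau)\circ\sigma=\sigma'\circ(\tau\times\tau)$ on $E$. (2) If $A$ and $A'$ are graded Morita equivalent, that is, if the categories of $\mathbb Z$-graded right modules (with degree-preserving homomorphisms) over $A$ and over $A'$ are equivalent as $k$-linear categories, then there is a sequence $(\tau_n)_{n\in\mathbb Z}$ of automorphisms of the variety $\mathbb P(V^*)$ such that for every $n\in\mathbb Z$ the map $\tau_n\times\tau_{n+1}$ restricts to an isomorphism $E\to E'$ and $(\tau_{n+1}\times\tau_{n+2})\circ\sigma=\sigma'\circ(\tau_n\times\tau_{n+1})$ on $E$. -/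

import Mathlib

open CategoryTheory
open scoped LinearAlgebra.Projectivization TensorProduct

universe u v w

noncomputable section

/-! ### Graded right modules over an `ℕ`-graded algebra -/

/-- A `ℤ`-graded right module `M = ⨁ᵢ Mᵢ` over the `k`-algebra `A = ⨁ᵢ Aᵢ` with graded pieces
`𝒜 i`. A right `A`-module is a module over `Aᵐᵒᵖ`; its `k`-vector space structure is the one
that comes from `k → A`. -/
structure GrMod {k : Type u} [Field k] {A : Type w} [Ring A] [Algebra k A]
    (𝒜 : ℕ → Submodule k A) where
  /-- the underlying module -/
  carrier : Type w
  [addCommGroup : AddCommGroup carrier]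
  [moduleBase : Module k carrier]
  [rightModule : Module Aᵐᵒᵖ carrier]
  [isScalarTower : IsScalarTower k Aᵐᵒᵖ carrier]
  /-- the piece of degree `i` -/
  piece : ℤ → Submodule k carrier
  isInternal : DirectSum.IsInternal piece
  smul_mem : ∀ (i : ℕ) (j : ℤ) (a : A) (m : carrier), a ∈ 𝒜 i → m ∈ piece j →
    MulOpposite.op a • m ∈ piece (j + i)

namespace GrMod

variable {k : Type u} [Field k] {A : Type w} [Ring A] [Algebra k A] {𝒜 : ℕ → Submodule k A}

attribute [instance] GrMod.addCommGroup GrMod.moduleBase GrMod.rightModule GrMod.isScalarTower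

/-- The `k`-vector space of right `A`-module homomorphisms that preserve degrees. -/
def homs (M N : GrMod 𝒜) : Submodule k (M.carrier →ₗ[Aᵐᵒᵖ] N.carrier) where
  carrier := {f | ∀ (i : ℤ) (m : M.carrier), m ∈ M.piece i → f m ∈ N.piece i}
  add_mem' := fun hf hg i m hm => (N.piece i).add_mem (hf i m hm) (hg i m hm)
  zero_mem' := fun i _ _ => (N.piece i).zero_mem
  smul_mem' := fun c _ hf i m hm => (N.piece i).smul_mem c (hf i m hm)

instance : Category (GrMod 𝒜) where
  Hom M N := homs M N
  id M := ⟨LinearMap.id, fun _ _ hm => hm⟩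
  comp f g := ⟨g.1.comp f.1, fun i m hm => g.2 i _ (f.2 i m hm)⟩

instance : Preadditive (GrMod 𝒜) where
  homGroup M N := inferInstanceAs (AddCommGroup (homs M N))
  add_comp _ _ _ f f' g := Subtype.ext (LinearMap.comp_add f.1 f'.1 g.1)
  comp_add _ _ _ f g g' := Subtype.ext (LinearMap.add_comp f.1 g'.1 g.1)

instance : Linear k (GrMod 𝒜) where
  homModule M N := inferInstanceAs (Module k (homs M N))
  smul_comp M N P r f g := by
    apply Subtype.ext
    apply LinearMap.ext
    intro m
    have h : ∀ (x : N.carrier), g.1 (r • x) = r • g.1 x := fun x => by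
      rw [← one_smul Aᵐᵒᵖ x, ← smul_assoc, map_smul, smul_assoc, map_smul]
    exact h (f.1 m)
  comp_smul _ _ _ _ _ _ := rfl

end GrMod

/-- Graded Morita equivalence of graded `k`-algebras: a `k`-linear equivalence of the categories
of graded right modules. -/
def GradedMoritaEquivalent {k : Type u} [Field k] {A A' : Type w} [Ring A] [Algebra k A]
    [Ring A'] [Algebra k A'] (𝒜 : ℕ → Submodule k A) (𝒜' : ℕ → Submodule k A') : Prop :=
  ∃ F : GrMod 𝒜 ≌ GrMod 𝒜', F.functor.Additive ∧ F.functor.Linear k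

/-- Isomorphism of graded `k`-algebras. -/
def GradedAlgIsomorphic {k : Type u} [Field k] {A A' : Type w} [Ring A] [Algebra k A]
    [Ring A'] [Algebra k A'] (𝒜 : ℕ → Submodule k A) (𝒜' : ℕ → Submodule k A') : Prop :=
  ∃ φ : A ≃ₐ[k] A', ∀ i, (𝒜 i).map φ.toLinearMap = 𝒜' i

/-! ### Regular maps between subvarieties of products of projective spaces -/

section Varieties

variable {k : Type u} [Field k] {W : Type w} [AddCommGroup W] [Module k W]

/-- Polynomials in the variables `(i, φ)`, with `φ` a linear functional on the `i`-th copy of `W`.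
Evaluation at `x : ι → W` sends `(i, φ)` to `φ (x i)`. -/
def evalPoly {ι : Type} (F : MvPolynomial (ι × Module.Dual k W) k) (x : ι → W) : k :=
  MvPolynomial.eval (fun c => c.2 (x c.1)) F

/-- `F` is multihomogeneous of multidegree `d`: of degree `d i` in the `i`-th copy of `W`. -/
def IsMultihomogeneous {ι : Type} [DecidableEq ι] (F : MvPolynomial (ι × Module.Dual k W) k)
    (d : ι → ℕ) : Prop :=
  MvPolynomial.IsWeightedHomogeneous (fun c : ι × Module.Dual k W => Pi.single c.1 (1 : ℕ)) F d

/-- A map `f : X → ℙ(W)` on a subset `X` of `ℙ(W)^ι` is regular if near every point `x` of `X` it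
is given by a `W`-valued multihomogeneous polynomial `∑ⱼ Fⱼ wⱼ` (all `Fⱼ` of the same
multidegree `d`), that is: the polynomial does not vanish at `x`, and `f` is given by it at all
points of `X` where it does not vanish. -/
def IsRegularMap {ι : Type} [DecidableEq ι] (X : Set (ι → ℙ k W)) (f : X → ℙ k W) : Prop :=
  ∀ x : X, ∃ (d : ι → ℕ) (n : ℕ) (wt : Fin n → W)
    (F : Fin n → MvPolynomial (ι × Module.Dual k W) k),
    (∀ j, IsMultihomogeneous (F j) d) ∧
    (∑ j, evalPoly (F j) (fun i => (x.1 i).rep) • wt j) ≠ 0 ∧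
    ∀ (y : X) (h : (∑ j, evalPoly (F j) (fun i => (y.1 i).rep) • wt j) ≠ 0),
      f y = Projectivization.mk k _ h

/-- Isomorphisms `X ≅ Y` of varieties, for `X ⊆ ℙ(W)^ι` and `Y ⊆ ℙ(W)^κ`: bijections that are
regular in both directions, where a map to a product is regular if its components are. -/
structure VarietyIso {ι κ : Type} [DecidableEq ι] [DecidableEq κ]
    (X : Set (ι → ℙ k W)) (Y : Set (κ → ℙ k W)) extends X ≃ Y where
  regular : ∀ j : κ, IsRegularMap X (fun x => (toEquiv x).1 j)
  regular_symm : ∀ i : ι, IsRegularMap Y (fun y => (toEquiv.symm y).1 i)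

variable (k W) in
/-- The automorphisms of the projective space `ℙ(W)` as a variety over `k`. -/
structure ProjAut extends ℙ k W ≃ ℙ k W where
  regular : IsRegularMap (Set.univ : Set (Fin 1 → ℙ k W)) (fun x => toEquiv (x.1 0))
  regular_symm : IsRegularMap (Set.univ : Set (Fin 1 → ℙ k W)) (fun x => toEquiv.symm (x.1 0))

/-- The map `τ₁ × τ₂` on `ℙ(W) × ℙ(W)`. -/
def ProjAut.prodMap (τ₁ τ₂ : ProjAut k W) (p : Fin 2 → ℙ k W) : Fin 2 → ℙ k W :=
  ![τ₁.toEquiv (p 0), τ₂.toEquiv (p 1)]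

/-- The projection `(p₁, p₂, p₃) ↦ (p₁, p₂)`. -/
def proj12 (p : Fin 3 → ℙ k W) : Fin 2 → ℙ k W := ![p 0, p 1]

/-- The projection `(p₁, p₂, p₃) ↦ (p₂, p₃)`. -/
def proj23 (p : Fin 3 → ℙ k W) : Fin 2 → ℙ k W := ![p 1, p 2]

/-- `f` sends `X` isomorphically onto its image. -/
def MapsIsomorphicallyOntoImage {ι κ : Type} [DecidableEq ι] [DecidableEq κ]
    (f : (ι → ℙ k W) → (κ → ℙ k W)) (X : Set (ι → ℙ k W)) : Prop :=
  ∃ e : VarietyIso X (f '' X), ∀ p : X, (e.toEquiv p).1 = f p.1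

end Varieties

/-! ### Cubic algebras and the condition (G1) -/

section Cubic

variable {k : Type u} [Field k] {V : Type v} [AddCommGroup V] [Module k V]

/-- The cubic algebra `T(V)/(R)` of a subspace `R ⊆ V ⊗ V ⊗ V`. -/
abbrev CubicAlgebra (R : Submodule k (⨂[k]^3 V)) : Type (max u v) :=
  (TwoSidedIdeal.span (TensorPower.toTensorAlgebra '' (R : Set (⨂[k]^3 V))) :
    TwoSidedIdeal (TensorAlgebra k V)).ringCon.Quotient

/-- The grading of `T(V)/(R)`: the piece of degree `i` is the image of `V^{⊗ i}`. -/
def CubicAlgebra.grading (R : Submodule k (⨂[k]^3 V)) (i : ℕ) : Submodule k (CubicAlgebra R) :=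
  (LinearMap.range (TensorAlgebra.ι k : V →ₗ[k] TensorAlgebra k V) ^ i).map
    (RingCon.mkₐ (α := k) (TwoSidedIdeal.span
      (TensorPower.toTensorAlgebra '' (R : Set (⨂[k]^3 V))) :
        TwoSidedIdeal (TensorAlgebra k V)).ringCon).toLinearMap

/-- The value of `f ∈ V ⊗ V ⊗ V` at `(ξ₁, ξ₂, ξ₃)` with `ξᵢ ∈ V*`, which is
`ξ₁(v₁) ξ₂(v₂) ξ₃(v₃)` for `f = v₁ ⊗ v₂ ⊗ v₃`. -/
def evalTensor (ξ : Fin 3 → Module.Dual k V) : (⨂[k]^3 V) →ₗ[k] k :=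
  PiTensorProduct.lift ((MultilinearMap.mkPiAlgebra k (Fin 3) k).compLinearMap ξ)

/-- The zero set `𝒱(R) ⊆ ℙ(V*) × ℙ(V*) × ℙ(V*)`. -/
def zeroSet (R : Submodule k (⨂[k]^3 V)) : Set (Fin 3 → ℙ k (Module.Dual k V)) :=
  {p | ∀ f ∈ R, evalTensor (fun i => (p i).rep) f = 0}

/-- The condition (G1) for `T(V)/(R)`. -/
structure SatisfiesG1 (R : Submodule k (⨂[k]^3 V)) : Prop where
  iso12 : MapsIsomorphicallyOntoImage proj12 (zeroSet R)
  iso23 : MapsIsomorphicallyOntoImage proj23 (zeroSet R)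
  image_eq : proj12 '' zeroSet R = proj23 '' zeroSet R

/-- The variety `E = π₁₂(𝒱(R))`. -/
def pointVariety (R : Submodule k (⨂[k]^3 V)) : Set (Fin 2 → ℙ k (Module.Dual k V)) :=
  proj12 '' zeroSet R

theorem MapsIsomorphicallyOntoImage.injOn {f : (Fin 3 → ℙ k (Module.Dual k V)) →
    (Fin 2 → ℙ k (Module.Dual k V))} {X : Set (Fin 3 → ℙ k (Module.Dual k V))}
    (h : MapsIsomorphicallyOntoImage f X) : Set.InjOn f X := by
  obtain ⟨e, he⟩ := h
  intro x hx y hy hxy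
  have h1 : e.toEquiv ⟨x, hx⟩ = e.toEquiv ⟨y, hy⟩ :=
    Subtype.ext ((he ⟨x, hx⟩).trans (hxy.trans (he ⟨y, hy⟩).symm))
  exact congrArg Subtype.val (e.toEquiv.injective h1)

/-- The automorphism `σ = π₂₃ ∘ π₁₂⁻¹` of `E`. -/
def pointAut {R : Submodule k (⨂[k]^3 V)} (h : SatisfiesG1 R) :
    pointVariety R ≃ pointVariety R :=
  (Equiv.Set.imageOfInjOn proj12 (zeroSet R) h.iso12.injOn).symm.trans
    ((Equiv.Set.imageOfInjOn proj23 (zeroSet R) h.iso23.injOn).trans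
      (Equiv.setCongr h.image_eq.symm))

end Cubic

end

/-!
Both parts reduce to linear automorphisms `θₙ` of `V`, for `n ∈ ℤ`, such that
`θₙ ⊗ θₙ₊₁ ⊗ θₙ₊₂` maps `R` onto `R'`. The maps `ξ ↦ ξ ∘ θₙ⁻¹` then induce automorphisms `τₙ` of
`ℙ(V*)`, the product `τₙ × τₙ₊₁ × τₙ₊₂` matches the two zero sets, and projecting to the first two
and to the last two factors gives the isomorphisms `E → E'` and their compatibility with `σ` and
`σ'` (`exists_varietyIso_of_map`).

The `θₙ` come from a family of injective linear maps `Φₙ : A_d → A'_d` with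
`Φₙ(a b) = Φₙ(a) Φₙ₊_d(b)` for `a ∈ A_d` (`GrMod.IsTwist`): `θₙ` is `Φₙ` on `A₁ = V`, and the
condition on `R` holds because `R` is the kernel of `V^{⊗3} → A₃`
(`exists_linearEquiv_of_isTwist`). A graded isomorphism is such a family, independent of `n`.

For an equivalence `F` of the categories of graded modules, one uses that `Hom(A(-n-d), A(-n))` is
`A_d`, with composition as multiplication. It suffices that `F` sends `A(-i)` to `A'(-i-c)` for a
constant `c` (`GrMod.exists_shift_index`, `GrMod.exists_isTwist`). The modules `A'(-j)` detect
nonzero morphisms, so some map `A'(-j) → F(A(-i))` remains nonzero after composition with the image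
under `F` of the projection of `A(-i)` to its simple quotient. The corresponding map
`F⁻¹(A'(-j)) → A(-i)` is nonzero in degree `i`, hence a split epimorphism, as `A₀ = k`. Therefore
`F(A(-i))` is a nonzero retract of `A'(-j)`, and it is all of `A'(-j)` because `End(A'(-j)) = k`
(`GrMod.exists_iso_shift`). The resulting permutation of `ℤ` is increasing if `A₁ ≠ 0`, hence a
translation. If `V = 0`, there is nothing to prove.
-/

/-! ### Linear automorphisms of projective space -/

noncomputable section

section Linear

variable {k : Type u} [Field k] {W : Type w} [AddCommGroup W] [Module k W]

/-- A linear automorphism applied to one coordinate is a regular map: in a basis of `W` it is given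
by polynomials that are linear in that coordinate and do not involve the others. -/
theorem isRegularMap_map [FiniteDimensional k W] {ι : Type} [DecidableEq ι]
    (X : Set (ι → ℙ k W)) (i : ι) (g : W ≃ₗ[k] W) :
    IsRegularMap X (fun x => Projectivization.map g.toLinearMap g.injective (x.1 i)) := by
  have key : ∀ x : X, (∑ j, evalPoly (MvPolynomial.X
      (i, (Module.finBasis k W).coord j ∘ₗ g.toLinearMap)) (fun i => (x.1 i).rep) •
        Module.finBasis k W j) = g (x.1 i).rep := by
    intro x
    simp only [evalPoly, MvPolynomial.eval_X]
    exact (Module.finBasis k W).sum_repr (g (x.1 i).rep)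
  intro x
  refine ⟨Pi.single i 1, Module.finrank k W, Module.finBasis k W,
    fun j => MvPolynomial.X (i, (Module.finBasis k W).coord j ∘ₗ g.toLinearMap), ?_, ?_, ?_⟩
  · intro j
    exact MvPolynomial.isWeightedHomogeneous_X k _ _
  · rw [key x]
    exact fun h => (x.1 i).rep_nonzero (g.map_eq_zero_iff.1 h)
  · intro y h
    have hy : Projectivization.mk k _ h = Projectivization.mk k (g (y.1 i).rep)
        (fun h => (y.1 i).rep_nonzero (g.map_eq_zero_iff.1 h)) := by
      congr 1
      exact key y
    rw [hy]
    change Projectivization.map g.toLinearMap g.injective (y.1 i) = _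
    conv_lhs => rw [← Projectivization.mk_rep (y.1 i)]
    rfl

/-- The automorphism of `ℙ(W)` induced by a linear automorphism of `W`. -/
def ProjAut.ofLinearEquiv [FiniteDimensional k W] (g : W ≃ₗ[k] W) : ProjAut k W where
  toFun := Projectivization.map g.toLinearMap g.injective
  invFun := Projectivization.map g.symm.toLinearMap g.symm.injective
  left_inv p := by
    induction p using Projectivization.ind with
    | h v hv => simp [Projectivization.map_mk]
  right_inv p := by
    induction p using Projectivization.ind with
    | h v hv => simp [Projectivization.map_mk]
  regular := isRegularMap_map Set.univ 0 g
  regular_symm := isRegularMap_map Set.univ 0 g.symm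

theorem ProjAut.ofLinearEquiv_apply [FiniteDimensional k W] (g : W ≃ₗ[k] W) (p : ℙ k W) :
    (ProjAut.ofLinearEquiv g).toEquiv p = Projectivization.map g.toLinearMap g.injective p :=
  rfl

theorem Projectivization.exists_rep_map (g : W ≃ₗ[k] W) (p : ℙ k W) :
    ∃ a : kˣ, (Projectivization.map g.toLinearMap g.injective p).rep = a • g p.rep := by
  have h := Projectivization.exists_smul_eq_mk_rep k (g p.rep)
    (fun h => p.rep_nonzero (g.map_eq_zero_iff.1 h))
  obtain ⟨a, ha⟩ := h
  refine ⟨a, ?_⟩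
  rw [ha]
  congr 1
  conv_lhs => rw [← Projectivization.mk_rep p]
  rfl

/-- A product of linear automorphisms that matches `X` with `Y` is an isomorphism of varieties. -/
def VarietyIso.ofLinearEquiv [FiniteDimensional k W] {X Y : Set (Fin 2 → ℙ k W)}
    (g h : W ≃ₗ[k] W)
    (hXY : ∀ p, p ∈ X ↔
      ProjAut.prodMap (ProjAut.ofLinearEquiv g) (ProjAut.ofLinearEquiv h) p ∈ Y) :
    VarietyIso X Y where
  toFun p := ⟨ProjAut.prodMap (ProjAut.ofLinearEquiv g) (ProjAut.ofLinearEquiv h) p.1,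
    (hXY p.1).1 p.2⟩
  invFun q := ⟨![(ProjAut.ofLinearEquiv g).toEquiv.symm (q.1 0),
      (ProjAut.ofLinearEquiv h).toEquiv.symm (q.1 1)], by
    rw [hXY]
    convert q.2
    ext i
    fin_cases i <;> simp [ProjAut.prodMap]⟩
  left_inv p := by
    ext i
    fin_cases i <;> simp [ProjAut.prodMap]
  right_inv p := by
    ext i
    fin_cases i <;> simp [ProjAut.prodMap]
  regular j := by
    fin_cases j
    · exact isRegularMap_map X 0 g
    · exact isRegularMap_map X 1 h
  regular_symm j := by
    fin_cases j
    · exact isRegularMap_map Y 0 g.symm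
    · exact isRegularMap_map Y 1 h.symm

end Linear

/-! ### Linear maps that match the relations -/

section ZeroSet

variable {k : Type u} [Field k] {V : Type v} [AddCommGroup V] [Module k V]

theorem evalTensor_tprod (ξ : Fin 3 → Module.Dual k V) (x : Fin 3 → V) :
    evalTensor ξ (PiTensorProduct.tprod k x) = ∏ i, ξ i (x i) := by
  simp [evalTensor, PiTensorProduct.lift.tprod]

theorem evalTensor_smul (c : Fin 3 → k) (ξ : Fin 3 → Module.Dual k V) (f : ⨂[k]^3 V) :
    evalTensor (fun i => c i • ξ i) f = (∏ i, c i) * evalTensor ξ f := by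
  have h : evalTensor (fun i => c i • ξ i) = (∏ i, c i) • evalTensor ξ := by
    apply PiTensorProduct.ext
    ext x
    simp [evalTensor_tprod, Finset.prod_mul_distrib]
  rw [h]
  rfl

theorem evalTensor_map (ξ : Fin 3 → Module.Dual k V) (θ : Fin 3 → V →ₗ[k] V) (f : ⨂[k]^3 V) :
    evalTensor ξ (PiTensorProduct.map θ f) = evalTensor (fun i => ξ i ∘ₗ θ i) f := by
  have h : evalTensor ξ ∘ₗ PiTensorProduct.map θ = evalTensor (fun i => ξ i ∘ₗ θ i) := by
    apply PiTensorProduct.ext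
    ext x
    simp [evalTensor_tprod]
  rw [← h]
  rfl

theorem pointAut_proj12 {R : Submodule k (⨂[k]^3 V)} (h : SatisfiesG1 R)
    (q : Fin 3 → ℙ k (Module.Dual k V)) (hq : q ∈ zeroSet R) :
    (pointAut h ⟨proj12 q, q, hq, rfl⟩).1 = proj23 q := by
  have : (Equiv.Set.imageOfInjOn proj12 (zeroSet R) h.iso12.injOn).symm ⟨proj12 q, q, hq, rfl⟩ =
      ⟨q, hq⟩ := by
    rw [Equiv.symm_apply_eq]
    rfl
  change (Equiv.Set.imageOfInjOn proj23 (zeroSet R) h.iso23.injOn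
    ((Equiv.Set.imageOfInjOn proj12 (zeroSet R) h.iso12.injOn).symm ⟨proj12 q, q, hq, rfl⟩)).1 = _
  rw [this]
  rfl

variable [FiniteDimensional k V]

/-- The automorphism `ξ ↦ ξ ∘ θ⁻¹` of `ℙ(V*)` induced by a linear automorphism `θ` of `V`. -/
def dualAut (θ : V ≃ₗ[k] V) : ProjAut k (Module.Dual k V) :=
  ProjAut.ofLinearEquiv θ.symm.dualMap

/-- If `θ₀ ⊗ θ₁ ⊗ θ₂` matches `R` with `R'`, the induced automorphism of `ℙ(V*)³` matches the two
zero sets. -/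
theorem mem_zeroSet_iff_of_map {R R' : Submodule k (⨂[k]^3 V)} (θ : Fin 3 → V ≃ₗ[k] V)
    (h : ∀ f, f ∈ R ↔ PiTensorProduct.map (fun i => (θ i).toLinearMap) f ∈ R')
    (p : Fin 3 → ℙ k (Module.Dual k V)) :
    p ∈ zeroSet R ↔ (fun i => (dualAut (θ i)).toEquiv (p i)) ∈ zeroSet R' := by
  choose a ha using fun i => Projectivization.exists_rep_map (θ i).symm.dualMap (p i)
  have key : ∀ f, evalTensor (fun i => ((dualAut (θ i)).toEquiv (p i)).rep)
      (PiTensorProduct.map (fun i => (θ i).toLinearMap) f) =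
        (∏ i, (a i : k)) * evalTensor (fun i => (p i).rep) f := by
    intro f
    rw [evalTensor_map, ← evalTensor_smul]
    congr 2
    ext i x
    rw [dualAut, ProjAut.ofLinearEquiv_apply, ha]
    simp [Units.smul_def]
  have hne : (∏ i, (a i : k)) ≠ 0 := Finset.prod_ne_zero_iff.2 fun i _ => (a i).ne_zero
  constructor
  · intro hp f hf
    obtain ⟨f, rfl⟩ := (PiTensorProduct.congr θ).surjective f
    change evalTensor _ (PiTensorProduct.map (fun i => (θ i).toLinearMap) f) = 0
    rw [key, hp f ((h f).2 hf), mul_zero]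
  · intro hp f hf
    have := hp _ ((h f).1 hf)
    rw [key] at this
    exact (mul_eq_zero.1 this).resolve_left hne

theorem mem_pointVariety_iff_of_map {R R' : Submodule k (⨂[k]^3 V)} (θ₀ θ₁ θ₂ : V ≃ₗ[k] V)
    (h : ∀ f, f ∈ R ↔ PiTensorProduct.map
      (fun i => ((![θ₀, θ₁, θ₂] : Fin 3 → V ≃ₗ[k] V) i).toLinearMap) f ∈ R')
    (p : Fin 2 → ℙ k (Module.Dual k V)) :
    p ∈ pointVariety R ↔ ProjAut.prodMap (dualAut θ₀) (dualAut θ₁) p ∈ pointVariety R' := by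
  have hz := mem_zeroSet_iff_of_map _ h
  constructor
  · rintro ⟨q, hq, rfl⟩
    refine ⟨_, (hz q).1 hq, ?_⟩
    ext i
    fin_cases i <;> rfl
  · rintro ⟨q, hq, hqp⟩
    have h0 : q 0 = (dualAut θ₀).toEquiv (p 0) := congrFun hqp 0
    have h1 : q 1 = (dualAut θ₁).toEquiv (p 1) := congrFun hqp 1
    refine ⟨![p 0, p 1, (dualAut θ₂).toEquiv.symm (q 2)], ?_, ?_⟩
    · rw [hz]
      convert hq with i
      fin_cases i
      · exact h0.symm
      · exact h1.symm
      · exact (dualAut θ₂).toEquiv.apply_symm_apply (q 2)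
    · ext i
      fin_cases i <;> rfl

theorem prodMap_pointAut {R R' : Submodule k (⨂[k]^3 V)} (hR : SatisfiesG1 R)
    (hR' : SatisfiesG1 R') (θ₀ θ₁ θ₂ : V ≃ₗ[k] V)
    (h : ∀ f, f ∈ R ↔ PiTensorProduct.map
      (fun i => ((![θ₀, θ₁, θ₂] : Fin 3 → V ≃ₗ[k] V) i).toLinearMap) f ∈ R')
    (p : pointVariety R) (p' : pointVariety R')
    (hp : p'.1 = ProjAut.prodMap (dualAut θ₀) (dualAut θ₁) p.1) :
    ProjAut.prodMap (dualAut θ₁) (dualAut θ₂) (pointAut hR p).1 = (pointAut hR' p').1 := by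
  obtain ⟨_, q, hq, rfl⟩ := p
  have hq' := (mem_zeroSet_iff_of_map _ h q).1 hq
  have hp' : p' = ⟨proj12 _, _, hq', rfl⟩ := by
    apply Subtype.ext
    rw [hp]
    ext i
    fin_cases i <;> rfl
  rw [hp', pointAut_proj12 hR q hq, pointAut_proj12 hR' _ hq']
  ext i
  fin_cases i <;> rfl

/-- A sequence `θ` of linear automorphisms of `V`, such that `θₙ ⊗ θₙ₊₁ ⊗ θₙ₊₂` matches `R` with
`R'` for all `n`, induces isomorphisms `E → E'` that intertwine `σ` and `σ'`. -/
theorem exists_varietyIso_of_map {R R' : Submodule k (⨂[k]^3 V)} (hR : SatisfiesG1 R)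
    (hR' : SatisfiesG1 R') (θ : ℤ → V ≃ₗ[k] V)
    (h : ∀ n f, f ∈ R ↔ PiTensorProduct.map (fun i =>
      ((![θ n, θ (n + 1), θ (n + 1 + 1)] : Fin 3 → V ≃ₗ[k] V) i).toLinearMap) f ∈ R') :
    ∃ e : ℤ → VarietyIso (pointVariety R) (pointVariety R'),
      (∀ n p, ((e n).toEquiv p).1 =
        ProjAut.prodMap (dualAut (θ n)) (dualAut (θ (n + 1))) p.1) ∧
      (∀ n p, (e (n + 1)).toEquiv (pointAut hR p) = pointAut hR' ((e n).toEquiv p)) := by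
  refine ⟨fun n => VarietyIso.ofLinearEquiv (θ n).symm.dualMap (θ (n + 1)).symm.dualMap
    (mem_pointVariety_iff_of_map _ _ _ (h n)), fun n p => rfl, fun n p => ?_⟩
  exact Subtype.ext (prodMap_pointAut hR hR' _ _ _ (h n) p _ rfl)

end ZeroSet
end

noncomputable section

namespace GrMod

/-! ### Morphisms of graded modules -/

section Hom

variable {k : Type u} [Field k] {A : Type w} [Ring A] [Algebra k A] {𝒜 : ℕ → Submodule k A}

/-- The underlying `A`-linear map of a morphism of graded modules. -/
def Hom.lin {M N : GrMod 𝒜} (f : M ⟶ N) : M.carrier →ₗ[Aᵐᵒᵖ] N.carrier := f.1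

theorem Hom.lin_mem {M N : GrMod 𝒜} (f : M ⟶ N) {i : ℤ} {m : M.carrier} (hm : m ∈ M.piece i) :
    Hom.lin f m ∈ N.piece i := f.2 i m hm

@[simp] theorem Hom.lin_id (M : GrMod 𝒜) (m : M.carrier) : Hom.lin (𝟙 M) m = m := rfl

@[simp] theorem Hom.lin_comp {M N P : GrMod 𝒜} (f : M ⟶ N) (g : N ⟶ P) (m : M.carrier) :
    Hom.lin (f ≫ g) m = Hom.lin g (Hom.lin f m) := rfl

@[simp] theorem Hom.lin_zero {M N : GrMod 𝒜} (m : M.carrier) :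
    Hom.lin (0 : M ⟶ N) m = 0 := rfl

@[simp] theorem Hom.lin_add {M N : GrMod 𝒜} (f g : M ⟶ N) (m : M.carrier) :
    Hom.lin (f + g) m = Hom.lin f m + Hom.lin g m := rfl

@[simp] theorem Hom.lin_smul {M N : GrMod 𝒜} (c : k) (f : M ⟶ N) (m : M.carrier) :
    Hom.lin (c • f) m = c • Hom.lin f m := rfl

theorem Hom.ext_lin {M N : GrMod 𝒜} {f g : M ⟶ N} (h : ∀ m, Hom.lin f m = Hom.lin g m) :
    f = g :=
  Subtype.ext (LinearMap.ext h)

theorem Hom.lin_map_smul {M N : GrMod 𝒜} (f : M ⟶ N) (c : k) (m : M.carrier) :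
    Hom.lin f (c • m) = c • Hom.lin f m := by
  rw [← one_smul Aᵐᵒᵖ m, ← smul_assoc, map_smul, smul_assoc, map_smul]

/-- A nonzero morphism is nonzero on some homogeneous element. -/
theorem Hom.exists_ne_zero {M N : GrMod 𝒜} {f : M ⟶ N} (hf : f ≠ 0) :
    ∃ i, ∃ m ∈ M.piece i, Hom.lin f m ≠ 0 := by
  by_contra! h
  refine hf (Hom.ext_lin fun m => ?_)
  have hm : m ∈ ⨆ i, M.piece i := by
    rw [M.isInternal.submodule_iSup_eq_top]
    trivial
  induction hm using Submodule.iSup_induction' with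
  | mem i x hx => exact h i x hx
  | zero => simp
  | add x y _ _ hx hy => simpa using by rw [hx, hy]; simp

end Hom

/-! ### The free modules of rank one and the simple modules -/

section Shift

variable {k : Type u} [Field k] {A : Type w} [Ring A] [Algebra k A] (𝒜 : ℕ → Submodule k A)

/-- The piece of degree `n` of `A(-i)`, which is `A_{n-i}`, and zero if `n < i`. -/
def shiftPiece (i n : ℤ) : Submodule k A := if i ≤ n then 𝒜 (n - i).toNat else ⊥

variable {𝒜} in
theorem mem_shiftPiece_iff {i n : ℤ} {d : ℕ} (h : n = i + d) {a : A} :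
    a ∈ shiftPiece 𝒜 i n ↔ a ∈ 𝒜 d := by
  subst h
  simp [shiftPiece]

theorem shiftPiece_of_lt {i n : ℤ} (h : n < i) : shiftPiece 𝒜 i n = ⊥ := by
  simp [shiftPiece, h.not_ge]

theorem isInternal_shiftPiece [GradedAlgebra 𝒜] (i : ℤ) :
    DirectSum.IsInternal (shiftPiece 𝒜 i) := by
  have hI := DirectSum.Decomposition.isInternal 𝒜
  have h𝒜 : ∀ d : ℕ, 𝒜 d = shiftPiece 𝒜 i (i + d) := fun d =>
    Submodule.ext fun a => (mem_shiftPiece_iff rfl).symm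
  refine DirectSum.isInternal_submodule_of_iSupIndep_of_iSup_eq_top (fun n => ?_) ?_
  · rcases lt_or_ge n i with hn | hn
    · simp [shiftPiece_of_lt 𝒜 hn]
    · obtain ⟨d, rfl⟩ := Int.le.dest hn
      rw [← h𝒜]
      refine (hI.submodule_iSupIndep d).mono_right (iSup₂_le fun m hm => ?_)
      rcases lt_or_ge m i with hm' | hm'
      · simp [shiftPiece_of_lt 𝒜 hm']
      · obtain ⟨e, rfl⟩ := Int.le.dest hm'
        rw [← h𝒜]
        exact le_iSup₂_of_le e (fun h => hm (by rw [h])) le_rfl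
  · rw [eq_top_iff, ← hI.submodule_iSup_eq_top]
    exact iSup_le fun d => (h𝒜 d).le.trans (le_iSup _ _)

/-- The free right module `A(-i)` on a generator of degree `i`. -/
def shift [GradedAlgebra 𝒜] (i : ℤ) : GrMod 𝒜 where
  carrier := A
  isScalarTower := ⟨fun c a x => by
    change x * (c • a.unop) = c • (x * a.unop)
    exact mul_smul_comm c x a.unop⟩
  piece := shiftPiece 𝒜 i
  isInternal := isInternal_shiftPiece 𝒜 i
  smul_mem d n a m ha hm := by
    change m * a ∈ _
    rcases lt_or_ge n i with hn | hn
    · rw [shiftPiece_of_lt 𝒜 hn, Submodule.mem_bot] at hm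
      simp [hm]
    · obtain ⟨e, rfl⟩ := Int.le.dest hn
      rw [mem_shiftPiece_iff rfl] at hm
      rw [mem_shiftPiece_iff (d := e + d) (by push_cast; ring)]
      exact SetLike.GradedMul.mul_mem hm ha

variable {𝒜} [GradedAlgebra 𝒜]

/-- The generator of `A(-i)`. -/
def gen (𝒜 : ℕ → Submodule k A) [GradedAlgebra 𝒜] (i : ℤ) : (shift 𝒜 i).carrier := (1 : A)

/-- The identification of the module `A(-i)` with `A`. -/
def shiftVal (𝒜 : ℕ → Submodule k A) [GradedAlgebra 𝒜] (i : ℤ) : (shift 𝒜 i).carrier ≃ₗ[k] A :=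
  LinearEquiv.refl k A

theorem shiftVal_mem {i n : ℤ} {d : ℕ} (h : n = i + d) {x : (shift 𝒜 i).carrier} :
    x ∈ (shift 𝒜 i).piece n ↔ shiftVal 𝒜 i x ∈ 𝒜 d :=
  mem_shiftPiece_iff (a := shiftVal 𝒜 i x) h

@[simp] theorem shiftVal_op_smul (i : ℤ) (a : A) (x : (shift 𝒜 i).carrier) :
    shiftVal 𝒜 i (MulOpposite.op a • x) = shiftVal 𝒜 i x * a := rfl

@[simp] theorem shiftVal_gen (i : ℤ) : shiftVal 𝒜 i (gen 𝒜 i) = 1 := rfl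

theorem gen_mem (i : ℤ) : gen 𝒜 i ∈ (shift 𝒜 i).piece i :=
  (shiftVal_mem (d := 0) (by simp)).2 (show (1 : A) ∈ 𝒜 0 from SetLike.GradedOne.one_mem)

theorem op_shiftVal_smul_gen {i : ℤ} (x : (shift 𝒜 i).carrier) :
    MulOpposite.op (shiftVal 𝒜 i x) • gen 𝒜 i = x :=
  (shiftVal 𝒜 i).injective (by simp)

/-- The morphism `A(-i) → M` that sends the generator to a given element of degree `i`. -/
def homOf (M : GrMod 𝒜) (i : ℤ) : M.piece i →ₗ[k] (shift 𝒜 i ⟶ M) where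
  toFun m := ⟨{
    toFun := fun x => MulOpposite.op (shiftVal 𝒜 i x) • m.1
    map_add' := fun x y => by rw [map_add, MulOpposite.op_add, add_smul]
    map_smul' := fun a x => by
      induction a using MulOpposite.rec' with | h a => ?_
      rw [shiftVal_op_smul, MulOpposite.op_mul, mul_smul, RingHom.id_apply] }, fun n x hx => by
    rcases lt_or_ge n i with hn | hn
    · have hx' : shiftVal 𝒜 i x ∈ shiftPiece 𝒜 i n := hx
      rw [shiftPiece_of_lt 𝒜 hn, Submodule.mem_bot] at hx'
      change MulOpposite.op (shiftVal 𝒜 i x) • m.1 ∈ _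
      rw [hx', MulOpposite.op_zero, zero_smul]
      exact zero_mem _
    · obtain ⟨d, rfl⟩ := Int.le.dest hn
      exact M.smul_mem d i _ m.1 ((shiftVal_mem rfl).1 hx) m.2⟩
  map_add' m m' := Hom.ext_lin fun x => smul_add (MulOpposite.op (shiftVal 𝒜 i x)) m.1 m'.1
  map_smul' c m := Hom.ext_lin fun x => by
    change MulOpposite.op (shiftVal 𝒜 i x) • c • m.1 = c • MulOpposite.op (shiftVal 𝒜 i x) • m.1
    rw [← one_smul Aᵐᵒᵖ m.1, ← smul_assoc c, ← mul_smul, ← mul_smul, ← smul_assoc c,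
      mul_smul_comm, mul_one]

@[simp] theorem lin_homOf_gen (M : GrMod 𝒜) (i : ℤ) (m : M.piece i) :
    Hom.lin (homOf M i m) (gen 𝒜 i) = m.1 := one_smul Aᵐᵒᵖ m.1

/-- A morphism from `A(-i)` is determined by the image of the generator. -/
theorem Hom.ext_gen {M : GrMod 𝒜} {i : ℤ} {f g : shift 𝒜 i ⟶ M}
    (h : Hom.lin f (gen 𝒜 i) = Hom.lin g (gen 𝒜 i)) : f = g := by
  refine Hom.ext_lin fun x => ?_
  rw [← op_shiftVal_smul_gen x, map_smul, map_smul, h]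

theorem shift_hom_eq_zero {i j : ℤ} (hij : i < j) (f : shift 𝒜 i ⟶ shift 𝒜 j) : f = 0 := by
  apply Hom.ext_gen
  have h : Hom.lin f (gen 𝒜 i) ∈ shiftPiece 𝒜 j i := Hom.lin_mem f (gen_mem i)
  rw [shiftPiece_of_lt 𝒜 hij] at h
  exact h

theorem id_shift_ne_zero [Nontrivial A] (i : ℤ) : 𝟙 (shift 𝒜 i) ≠ 0 := fun h => by
  have := congrArg (fun f => Hom.lin f (gen 𝒜 i)) h
  exact one_ne_zero (α := A) this

theorem eq_of_iso_shift [Nontrivial A] {i j : ℤ} (e : shift 𝒜 i ≅ shift 𝒜 j) : i = j := by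
  rcases lt_trichotomy i j with h | h | h
  · exact absurd (by rw [← e.hom_inv_id, shift_hom_eq_zero h e.hom, Limits.zero_comp])
      (id_shift_ne_zero (𝒜 := 𝒜) i)
  · exact h
  · exact absurd (by rw [← e.hom_inv_id, shift_hom_eq_zero h e.inv, Limits.comp_zero])
      (id_shift_ne_zero (𝒜 := 𝒜) i)

/-- The right `A`-module structure on `A₀` along the ring map `A → A₀` that kills the elements of
positive degree. -/
@[reducible] def zeroPieceModule (𝒜 : ℕ → Submodule k A) [GradedAlgebra 𝒜] :
    Module Aᵐᵒᵖ (𝒜 0) :=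
  Module.compHom (𝒜 0) (RingHom.op (GradedRing.projZeroRingHom' 𝒜))

theorem coe_zeroPieceModule_smul (a : A) (x : 𝒜 0) :
    ((letI := zeroPieceModule 𝒜; MulOpposite.op a • x : 𝒜 0) : A) =
      x * (DirectSum.decompose 𝒜 a 0 : A) := rfl

/-- The module `A/A_{≥1} = A₀`, placed in degree `i`. It is simple if `A₀ = k`. -/
def simple (𝒜 : ℕ → Submodule k A) [GradedAlgebra 𝒜] (i : ℤ) : GrMod 𝒜 :=
  letI := zeroPieceModule 𝒜
  { carrier := 𝒜 0
    isScalarTower := ⟨fun c a x => by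
      apply Subtype.ext
      induction a using MulOpposite.rec' with | h a => ?_
      rw [← MulOpposite.op_smul, coe_zeroPieceModule_smul, Submodule.coe_smul,
        coe_zeroPieceModule_smul, DirectSum.decompose_smul]
      exact mul_smul_comm c _ _⟩
    piece := fun n => if n = i then ⊤ else ⊥
    isInternal := by
      refine DirectSum.isInternal_submodule_of_iSupIndep_of_iSup_eq_top (fun n => ?_) ?_
      · by_cases hn : n = i
        · have : (⨆ m, ⨆ (_ : m ≠ n), if m = i then (⊤ : Submodule k (𝒜 0)) else ⊥) = ⊥ := by
            simp only [iSup_eq_bot]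
            intro m hm
            rw [if_neg (hn ▸ hm)]
          rw [this]
          exact disjoint_bot_right
        · simp [hn]
      · exact eq_top_iff.2 (le_iSup_of_le i (by simp))
    smul_mem := fun d n a m ha hm => by
      by_cases hn : n = i
      · subst hn
        rcases Nat.eq_zero_or_pos d with rfl | hd
        · simp
        · have : (MulOpposite.op a • m : 𝒜 0) = 0 := by
            apply Subtype.ext
            rw [coe_zeroPieceModule_smul, DirectSum.decompose_of_mem_ne 𝒜 ha hd.ne', mul_zero]
            rfl
          rw [this]
          exact zero_mem _
      · rw [if_neg hn, Submodule.mem_bot] at hm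
        rw [hm, smul_zero]
        exact zero_mem _ }

theorem eq_zero_of_mem_simple_piece {i n : ℤ} (h : n ≠ i) {x : (simple 𝒜 i).carrier}
    (hx : x ∈ (simple 𝒜 i).piece n) : x = 0 := by
  change x ∈ (if n = i then (⊤ : Submodule k (𝒜 0)) else ⊥) at hx
  rw [if_neg h] at hx
  exact hx

theorem exists_shift_to_simple_ne_zero [Nontrivial A] (i : ℤ) :
    ∃ s : shift 𝒜 i ⟶ simple 𝒜 i, s ≠ 0 := by
  have h1 : (1 : 𝒜 0) ∈ (if i = i then (⊤ : Submodule k (𝒜 0)) else ⊥) := by simp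
  refine ⟨homOf (simple 𝒜 i) i ⟨(1 : 𝒜 0), h1⟩, fun h => ?_⟩
  have h2 := lin_homOf_gen (simple 𝒜 i) i ⟨(1 : 𝒜 0), h1⟩
  rw [h] at h2
  exact one_ne_zero (α := A) (congrArg Subtype.val h2).symm

end Shift

/-! ### Equivalences permute the free modules of rank one -/

section Equivalence

variable {k : Type u} [Field k] {A A' : Type w} [Ring A] [Algebra k A] [Ring A'] [Algebra k A']
  {𝒜 : ℕ → Submodule k A} {𝒜' : ℕ → Submodule k A'} [GradedAlgebra 𝒜] [GradedAlgebra 𝒜']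

/-- Over a connected graded algebra, an endomorphism of `A(-i)` is a scalar. -/
theorem exists_smul_id (h0 : ∀ a ∈ 𝒜 0, ∃ c : k, a = algebraMap k A c) {i : ℤ}
    (f : shift 𝒜 i ⟶ shift 𝒜 i) : ∃ c : k, f = c • 𝟙 (shift 𝒜 i) := by
  obtain ⟨c, hc⟩ := h0 _ ((shiftVal_mem (d := 0) (by simp)).1 (Hom.lin_mem f (gen_mem i)))
  refine ⟨c, Hom.ext_gen ((shiftVal 𝒜 i).injective ?_)⟩
  rw [hc, Hom.lin_smul, Hom.lin_id, map_smul, shiftVal_gen, Algebra.algebraMap_eq_smul_one]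

/-- An equivalence sends the modules `A(-i)` to modules of the same kind. A nonzero map from
`A(-i)` to the simple module in degree `i` is detected, after the equivalence, by some `A'(-j)`;
this makes the image of `A(-i)` a retract of `A'(-j)`, whose only endomorphisms are the scalars. -/
theorem exists_iso_shift [Nontrivial A] (h0 : ∀ a ∈ 𝒜 0, ∃ c : k, a = algebraMap k A c)
    (h0' : ∀ a ∈ 𝒜' 0, ∃ c : k, a = algebraMap k A' c)
    (F : GrMod 𝒜 ≌ GrMod 𝒜') [F.functor.Additive] (i : ℤ) :
    ∃ j, Nonempty (F.functor.obj (shift 𝒜 i) ≅ shift 𝒜' j) := by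
  obtain ⟨s, hs⟩ := exists_shift_to_simple_ne_zero (𝒜 := 𝒜) i
  have hFs : F.functor.map s ≠ 0 := fun h => hs (F.functor.map_injective (by simpa using h))
  obtain ⟨j, y, hy, hsy⟩ := Hom.exists_ne_zero hFs
  let adj := F.symm.toAdjunction
  let u : shift 𝒜' j ⟶ F.functor.obj (shift 𝒜 i) := homOf _ j ⟨y, hy⟩
  let t : F.inverse.obj (shift 𝒜' j) ⟶ shift 𝒜 i := (adj.homEquiv _ _).symm u
  -- Under the adjunction, `t ≫ s` corresponds to `u ≫ F(s)`, which sends the generator to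
  -- `F(s)(y) ≠ 0`.
  have hts : t ≫ s ≠ 0 := by
    intro h
    have h1 : adj.homEquiv _ _ (t ≫ s) = u ≫ F.functor.map s := by
      rw [adj.homEquiv_naturality_right]
      simp only [t, Equiv.apply_symm_apply]
      rfl
    have h2 : adj.homEquiv (shift 𝒜' j) (simple 𝒜 i) 0 = 0 := by
      rw [Adjunction.homEquiv_unit]
      erw [F.functor.map_zero]
      exact Limits.comp_zero
    rw [h, h2] at h1
    apply hsy
    have h3 := congrArg (fun f => Hom.lin f (gen 𝒜' j)) h1
    simp only [Hom.lin_zero, Hom.lin_comp, u, lin_homOf_gen] at h3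
    exact h3.symm
  obtain ⟨l, x, hx, htx⟩ := Hom.exists_ne_zero hts
  obtain rfl : l = i := by
    by_contra hl
    exact htx (eq_zero_of_mem_simple_piece hl (Hom.lin_mem _ hx))
  -- `t x` is a nonzero scalar multiple of the generator, so `t` has a section `r`.
  obtain ⟨c, hc⟩ := h0 _ ((shiftVal_mem (d := 0) (by simp)).1 (Hom.lin_mem t hx))
  have hc' : Hom.lin t x = c • gen 𝒜 l := (shiftVal 𝒜 l).injective <| by
    rw [hc, map_smul, shiftVal_gen, Algebra.algebraMap_eq_smul_one]
  have hc0 : c ≠ 0 := by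
    rintro rfl
    apply htx
    rw [Hom.lin_comp, hc', zero_smul, map_zero]
  let r : shift 𝒜 l ⟶ F.inverse.obj (shift 𝒜' j) :=
    homOf _ l ⟨c⁻¹ • x, Submodule.smul_mem _ _ hx⟩
  have hrt : r ≫ t = 𝟙 _ := by
    apply Hom.ext_gen
    rw [Hom.lin_comp, lin_homOf_gen, Hom.lin_map_smul, hc', smul_smul, inv_mul_cancel₀ hc0,
      one_smul, Hom.lin_id]
  let a : F.functor.obj (shift 𝒜 l) ⟶ shift 𝒜' j :=
    F.functor.map r ≫ F.counitIso.hom.app (shift 𝒜' j)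
  let b : shift 𝒜' j ⟶ F.functor.obj (shift 𝒜 l) :=
    F.counitIso.inv.app (shift 𝒜' j) ≫ F.functor.map t
  have hab : a ≫ b = 𝟙 _ := by
    have h1 : F.counitIso.hom.app (shift 𝒜' j) ≫ F.counitIso.inv.app (shift 𝒜' j) ≫
        F.functor.map t = F.functor.map t := by
      rw [← Category.assoc, F.counitIso.hom_inv_id_app]
      exact Category.id_comp _
    change (F.functor.map r ≫ _) ≫ _ = _
    rw [Category.assoc, h1, ← F.functor.map_comp, hrt, F.functor.map_id]
  -- The other composite is a scalar `e`, with `e a = a` because `a ≫ b` is the identity.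
  obtain ⟨e, he⟩ := exists_smul_id h0' (b ≫ a)
  have ha : a ≠ 0 := by
    intro ha
    rw [ha, Limits.zero_comp] at hab
    refine id_shift_ne_zero (𝒜 := 𝒜) l (F.functor.map_injective ?_)
    rw [F.functor.map_id, F.functor.map_zero, hab]
  have he1 : e = 1 := by
    have hea : e • a = a := by
      rw [← Category.comp_id (e • a), Linear.smul_comp, ← Linear.comp_smul, ← he,
        ← Category.assoc, hab, Category.id_comp]
    have h2 : (e - 1) • a = 0 := by rw [sub_smul, one_smul, hea, sub_self]
    exact sub_eq_zero.1 ((smul_eq_zero.1 h2).resolve_right ha)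
  refine ⟨j, ⟨⟨a, b, hab, ?_⟩⟩⟩
  rw [he, he1, one_smul]

/-- If `A₁ ≠ 0`, an equivalence shifts the degrees of the modules `A(-i)` by a constant: it permutes
them, and the permutation is increasing because there are no nonzero maps `A(-i) → A(-j)` for
`i < j`. -/
theorem exists_shift_index [Nontrivial A] [Nontrivial A']
    (h0 : ∀ a ∈ 𝒜 0, ∃ c : k, a = algebraMap k A c)
    (h0' : ∀ a ∈ 𝒜' 0, ∃ c : k, a = algebraMap k A' c) (h1 : 𝒜 1 ≠ ⊥)
    (F : GrMod 𝒜 ≌ GrMod 𝒜') [F.functor.Additive] :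
    ∃ π : ℤ → ℤ, (∀ i, π (i + 1) = π i + 1) ∧
      ∀ i, Nonempty (F.functor.obj (shift 𝒜 i) ≅ shift 𝒜' (π i)) := by
  choose π α using exists_iso_shift h0 h0' F
  refine ⟨π, ?_, α⟩
  have hinj : Function.Injective π := fun i j hij => by
    obtain ⟨a⟩ := α i
    obtain ⟨b⟩ := α j
    rw [hij] at a
    exact eq_of_iso_shift (F.functor.preimageIso (a ≪≫ b.symm))
  have hsurj : Function.Surjective π := fun j => by
    have : F.symm.functor.Additive := inferInstanceAs F.inverse.Additive
    obtain ⟨i, ⟨b⟩⟩ := exists_iso_shift h0' h0 F.symm j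
    obtain ⟨a⟩ := α i
    exact ⟨i, eq_of_iso_shift (a.symm ≪≫ F.functor.mapIso b.symm ≪≫ F.counitIso.app _)⟩
  have hmono : StrictMono π := by
    refine strictMono_int_of_lt_succ fun i => lt_of_le_of_ne ?_ fun h => ?_
    · by_contra! hlt
      obtain ⟨x, hx, hx0⟩ := Submodule.exists_mem_ne_zero_of_ne_bot h1
      have hx' : x ∈ shiftPiece 𝒜 i (i + 1) := (mem_shiftPiece_iff (by simp)).2 hx
      let f : shift 𝒜 (i + 1) ⟶ shift 𝒜 i := homOf (shift 𝒜 i) (i + 1) ⟨x, hx'⟩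
      obtain ⟨a⟩ := α i
      obtain ⟨b⟩ := α (i + 1)
      have h2 := shift_hom_eq_zero hlt (b.inv ≫ F.functor.map f ≫ a.hom)
      rw [Preadditive.IsIso.comp_left_eq_zero, Preadditive.IsIso.comp_right_eq_zero] at h2
      have h3 : f = 0 := F.functor.map_injective (by rw [h2, F.functor.map_zero])
      apply hx0
      have h4 := lin_homOf_gen (shift 𝒜 i) (i + 1) ⟨x, hx'⟩
      change Hom.lin f _ = x at h4
      rw [← h4, h3]
      rfl
    · simpa using hinj h
  intro i
  refine le_antisymm ?_ (hmono (lt_add_one i))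
  obtain ⟨m, hm⟩ := hsurj (π i + 1)
  rw [← hm]
  refine hmono.monotone (Int.add_one_le_iff.2 (hmono.lt_iff_lt.1 ?_))
  rw [hm]
  exact lt_add_one _

/-- A family of injective linear maps `Φₙ : A_d → A'_d`, for `n ∈ ℤ`, that satisfies the identity
`Φₙ(a b) = Φₙ(a) Φₙ₊_d(b)` for `a ∈ A_d`. If the maps are bijective, this exhibits `A'` as a twist
of `A`. -/
structure IsTwist (Φ : ℤ → ∀ d : ℕ, 𝒜 d →ₗ[k] 𝒜' d) : Prop where
  injective : ∀ n d, Function.Injective (Φ n d)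
  map_mul : ∀ (n : ℤ) (d e : ℕ) (a : 𝒜 d) (b : 𝒜 e),
    (Φ n (d + e) ⟨a.1 * b.1, SetLike.GradedMul.mul_mem a.2 b.2⟩ : A') =
      (Φ n d a : A') * (Φ (n + d) e b : A')

/-- Left multiplication by an element of degree `d`, as a morphism `A(-i) → A(-j)` for
`i = j + d`. -/
def mulLeft (𝒜 : ℕ → Submodule k A) [GradedAlgebra 𝒜] {i j : ℤ} {d : ℕ} (h : i = j + d) :
    𝒜 d →ₗ[k] (shift 𝒜 i ⟶ shift 𝒜 j) :=
  homOf (shift 𝒜 j) i ∘ₗ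
    ((shiftVal 𝒜 j).symm.toLinearMap ∘ₗ (𝒜 d).subtype).codRestrict ((shift 𝒜 j).piece i)
      fun a => (shiftVal_mem h).2 (by simp)

@[simp] theorem lin_mulLeft_gen {i j : ℤ} {d : ℕ} (h : i = j + d) (a : 𝒜 d) :
    Hom.lin (mulLeft 𝒜 h a) (gen 𝒜 i) = (shiftVal 𝒜 j).symm a.1 :=
  lin_homOf_gen _ _ _

theorem shiftVal_lin {i j : ℤ} (f : shift 𝒜 i ⟶ shift 𝒜 j) (x : (shift 𝒜 i).carrier) :
    shiftVal 𝒜 j (Hom.lin f x) = shiftVal 𝒜 j (Hom.lin f (gen 𝒜 i)) * shiftVal 𝒜 i x := by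
  conv_lhs => rw [← op_shiftVal_smul_gen x, map_smul, shiftVal_op_smul]

theorem mulLeft_injective {i j : ℤ} {d : ℕ} (h : i = j + d) :
    Function.Injective (mulLeft 𝒜 h) := fun a b hab => by
  apply Subtype.ext
  apply (shiftVal 𝒜 j).symm.injective
  rw [← lin_mulLeft_gen h, hab, lin_mulLeft_gen]

theorem mulLeft_mul {i j l : ℤ} {d e : ℕ} (h : i = j + e) (h' : j = l + d)
    (h'' : i = l + (d + e : ℕ)) (a : 𝒜 d) (b : 𝒜 e) :
    mulLeft 𝒜 h'' ⟨a.1 * b.1, SetLike.GradedMul.mul_mem a.2 b.2⟩ =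
      mulLeft 𝒜 h b ≫ mulLeft 𝒜 h' a := by
  apply Hom.ext_gen
  apply (shiftVal 𝒜 l).injective
  rw [Hom.lin_comp, shiftVal_lin (mulLeft 𝒜 h' a) (Hom.lin (mulLeft 𝒜 h b) _)]
  simp

/-- A linear equivalence between the categories of graded modules makes the two algebras twists of
each other. The maps `Φₙ` are the action of the equivalence on the spaces
`Hom(A(-n-d), A(-n)) = A_d`. -/
theorem exists_isTwist [Nontrivial A] [Nontrivial A']
    (h0 : ∀ a ∈ 𝒜 0, ∃ c : k, a = algebraMap k A c)
    (h0' : ∀ a ∈ 𝒜' 0, ∃ c : k, a = algebraMap k A' c) (h1 : 𝒜 1 ≠ ⊥)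
    (F : GrMod 𝒜 ≌ GrMod 𝒜') [F.functor.Additive] [F.functor.Linear k] :
    ∃ Φ : ℤ → ∀ d : ℕ, 𝒜 d →ₗ[k] 𝒜' d, IsTwist Φ := by
  obtain ⟨π, hπ, α⟩ := exists_shift_index h0 h0' h1 F
  replace α := fun i => (α i).some
  have hπd : ∀ (n : ℤ) (d : ℕ), π (n + d) = π n + d := by
    intro n d
    induction d with
    | zero => simp
    | succ d ih => rw [Nat.cast_succ, ← add_assoc, hπ, ih, add_assoc]
  let conj : ∀ i j, (shift 𝒜 i ⟶ shift 𝒜 j) → (shift 𝒜' (π i) ⟶ shift 𝒜' (π j)) :=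
    fun i j f => (α i).inv ≫ F.functor.map f ≫ (α j).hom
  let tr : ∀ i j, (shift 𝒜 i ⟶ shift 𝒜 j) →ₗ[k] A' := fun i j =>
    { toFun := fun f => shiftVal 𝒜' (π j) (Hom.lin (conj i j f) (gen 𝒜' (π i)))
      map_add' := fun f g => by simp [conj]
      map_smul' := fun c f => by
        simp only [conj, F.functor.map_smul, Linear.smul_comp, Linear.comp_smul, Hom.lin_smul,
          map_smul, RingHom.id_apply] }
  have tr_inj : ∀ i j, Function.Injective (tr i j) := fun i j f g hfg => by
    have h : conj i j f = conj i j g := Hom.ext_gen ((shiftVal 𝒜' (π j)).injective hfg)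
    exact F.functor.map_injective ((cancel_mono _).1 ((cancel_epi _).1 h))
  have tr_comp : ∀ i j l (g : shift 𝒜 i ⟶ shift 𝒜 j) (f : shift 𝒜 j ⟶ shift 𝒜 l),
      tr i l (g ≫ f) = tr j l f * tr i j g := fun i j l g f => by
    have h : conj i l (g ≫ f) = conj i j g ≫ conj j l f := by simp [conj]
    change shiftVal 𝒜' (π l) (Hom.lin (conj i l (g ≫ f)) _) = _
    rw [h, Hom.lin_comp, shiftVal_lin]
    rfl
  have tr_mem : ∀ (n : ℤ) (d : ℕ) (f : shift 𝒜 (n + d) ⟶ shift 𝒜 n),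
      tr (n + d) n f ∈ 𝒜' d := fun n d f =>
    (shiftVal_mem (hπd n d)).1 (Hom.lin_mem (conj (n + d) n f) (gen_mem (π (n + d))))
  refine ⟨fun n d => (tr (n + d) n ∘ₗ mulLeft 𝒜 rfl).codRestrict _ fun a => tr_mem n d _,
    fun n d a b hab => ?_, fun n d e a b => ?_⟩
  · exact mulLeft_injective rfl (tr_inj _ _ (congrArg Subtype.val hab))
  · -- `n + (d + e)` and `(n + d) + e` are equal only propositionally.
    have key : ∀ (i : ℤ) (h : i = n + (d + e : ℕ)) (c : 𝒜 (d + e)),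
        tr (n + (d + e : ℕ)) n (mulLeft 𝒜 rfl c) = tr i n (mulLeft 𝒜 h c) := by
      rintro i rfl c
      rfl
    change tr (n + (d + e : ℕ)) n (mulLeft 𝒜 rfl _) =
      tr (n + d) n (mulLeft 𝒜 rfl a) * tr (n + d + e) (n + d) (mulLeft 𝒜 rfl b)
    rw [key (n + d + e) (by push_cast; ring), ← tr_comp, mulLeft_mul]

end Equivalence
end GrMod
end

/-! ### The grading of a cubic algebra -/

noncomputable section

section CubicGrading

variable {k : Type u} [Field k] {V : Type v} [AddCommGroup V] [Module k V]

variable (k V) in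
/-- The piece of degree `n` of the tensor algebra. -/
abbrev tensorPiece (n : ℕ) : Submodule k (TensorAlgebra k V) :=
  LinearMap.range (TensorAlgebra.ι k : V →ₗ[k] TensorAlgebra k V) ^ n

theorem ι_mem_tensorPiece (v : V) : TensorAlgebra.ι k v ∈ tensorPiece k V 1 := by
  rw [tensorPiece, pow_one]
  exact LinearMap.mem_range_self _ v

theorem toTensorAlgebra_tprod_three (x : Fin 3 → V) :
    TensorPower.toTensorAlgebra (PiTensorProduct.tprod k x) =
      TensorAlgebra.ι k (x 0) * (TensorAlgebra.ι k (x 1) * TensorAlgebra.ι k (x 2)) := by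
  simp [TensorAlgebra.tprod_apply, List.ofFn_succ]

theorem toTensorAlgebra_mem (f : ⨂[k]^3 V) :
    TensorPower.toTensorAlgebra f ∈ tensorPiece k V 3 := by
  induction f using PiTensorProduct.induction_on with
  | smul_tprod r x =>
    rw [map_smul, toTensorAlgebra_tprod_three]
    refine Submodule.smul_mem _ r ?_
    have h := SetLike.GradedMul.mul_mem (ι_mem_tensorPiece (k := k) (x 0))
      (SetLike.GradedMul.mul_mem (ι_mem_tensorPiece (k := k) (x 1))
        (ι_mem_tensorPiece (k := k) (x 2)))
    exact h
  | add x y hx hy =>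
    rw [map_add]
    exact add_mem hx hy

theorem toTensorAlgebra_injective :
    Function.Injective (TensorPower.toTensorAlgebra : (⨂[k]^3 V) →ₗ[k] TensorAlgebra k V) := by
  intro f g hfg
  have h : ∀ f : ⨂[k]^3 V, TensorAlgebra.ofDirectSum (DirectSum.of (fun n => ⨂[k]^n V) 3 f) =
      TensorPower.toTensorAlgebra f := fun f =>
    DirectSum.toAddMonoid_of (fun _ => LinearMap.toAddMonoidHom TensorPower.toTensorAlgebra) _ _
  rw [← h f, ← h g] at hfg
  exact DirectSum.of_injective (β := fun n => ⨂[k]^n V) 3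
    ((TensorAlgebra.equivDirectSum (R := k) (M := V)).symm.injective hfg)

namespace CubicAlgebra

variable (R : Submodule k (⨂[k]^3 V))

/-- The quotient map `T(V) → T(V)/(R)`. -/
def quot : TensorAlgebra k V →ₐ[k] CubicAlgebra R :=
  RingCon.mkₐ (α := k) (TwoSidedIdeal.span
    (TensorPower.toTensorAlgebra '' (R : Set (⨂[k]^3 V))) :
      TwoSidedIdeal (TensorAlgebra k V)).ringCon

theorem quot_surjective : Function.Surjective (quot R) := RingCon.mkₐ_surjective _

variable {R}

theorem quot_eq_zero_iff {x : TensorAlgebra k V} :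
    quot R x = 0 ↔ x ∈ TwoSidedIdeal.span
      (TensorPower.toTensorAlgebra '' (R : Set (⨂[k]^3 V))) :=
  RingCon.eq _

theorem quot_mem {n : ℕ} {x : TensorAlgebra k V} (hx : x ∈ tensorPiece k V n) :
    quot R x ∈ grading R n := ⟨x, hx, rfl⟩

variable (R) in
/-- The elements of `T(V)` without components in degrees `0, 1, 2`, whose component in degree `3`
is in `R`. They form a two-sided ideal, which contains `(R)`. -/
def truncSubmodule : Submodule k (TensorAlgebra k V) where
  carrier := {x | (∀ n < 3, (DirectSum.decompose (tensorPiece k V) x n : TensorAlgebra k V) = 0) ∧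
    (DirectSum.decompose (tensorPiece k V) x 3 : TensorAlgebra k V) ∈
      R.map TensorPower.toTensorAlgebra}
  add_mem' := fun ⟨hx, hx'⟩ ⟨hy, hy'⟩ => by
    constructor
    · intro n hn
      rw [DirectSum.decompose_add, DirectSum.add_apply, Submodule.coe_add, hx n hn, hy n hn,
        add_zero]
    · rw [DirectSum.decompose_add, DirectSum.add_apply, Submodule.coe_add]
      exact add_mem hx' hy'
  zero_mem' := by
    constructor
    · intro n _
      rw [DirectSum.decompose_zero, DirectSum.zero_apply, Submodule.coe_zero]
    · rw [DirectSum.decompose_zero, DirectSum.zero_apply, Submodule.coe_zero]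
      exact zero_mem _
  smul_mem' := fun c x ⟨hx, hx'⟩ => by
    constructor
    · intro n hn
      rw [DirectSum.decompose_smul, DirectSum.smul_apply, Submodule.coe_smul, hx n hn, smul_zero]
    · rw [DirectSum.decompose_smul, DirectSum.smul_apply, Submodule.coe_smul]
      exact Submodule.smul_mem _ c hx'

theorem mul_mem_truncSubmodule_left (a : TensorAlgebra k V) {x : TensorAlgebra k V}
    (hx : x ∈ truncSubmodule R) : a * x ∈ truncSubmodule R := by
  induction a using TensorAlgebra.induction generalizing x with
  | algebraMap r =>
    rw [← Algebra.smul_def]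
    exact Submodule.smul_mem _ r hx
  | ι v =>
    have h : ∀ n < 3, (DirectSum.decompose (tensorPiece k V) (TensorAlgebra.ι k v * x) (1 + n) :
        TensorAlgebra k V) = 0 := fun n hn => by
      rw [DirectSum.coe_decompose_mul_add_of_left_mem _ (ι_mem_tensorPiece v), hx.1 n hn, mul_zero]
    have h0 : (DirectSum.decompose (tensorPiece k V) (TensorAlgebra.ι k v * x) 0 :
        TensorAlgebra k V) = 0 :=
      DirectSum.coe_decompose_mul_of_left_mem_of_not_le _ (ι_mem_tensorPiece v) (by simp)
    refine ⟨fun n hn => ?_, ?_⟩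
    · cases n with
      | zero => exact h0
      | succ n => rw [add_comm]; exact h n (by omega)
    · have h3 := h 2 (by omega)
      simp only [Nat.reduceAdd] at h3
      rw [h3]
      exact zero_mem _
  | mul a b ha hb => rw [mul_assoc]; exact ha (hb hx)
  | add a b ha hb => rw [add_mul]; exact add_mem (ha hx) (hb hx)

theorem mul_mem_truncSubmodule_right (a : TensorAlgebra k V) {x : TensorAlgebra k V}
    (hx : x ∈ truncSubmodule R) : x * a ∈ truncSubmodule R := by
  induction a using TensorAlgebra.induction generalizing x with
  | algebraMap r =>
    rw [← Algebra.commutes, ← Algebra.smul_def]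
    exact Submodule.smul_mem _ r hx
  | ι v =>
    have h : ∀ n < 3, (DirectSum.decompose (tensorPiece k V) (x * TensorAlgebra.ι k v) (n + 1) :
        TensorAlgebra k V) = 0 := fun n hn => by
      rw [DirectSum.coe_decompose_mul_add_of_right_mem _ (ι_mem_tensorPiece v), hx.1 n hn,
        zero_mul]
    have h0 : (DirectSum.decompose (tensorPiece k V) (x * TensorAlgebra.ι k v) 0 :
        TensorAlgebra k V) = 0 :=
      DirectSum.coe_decompose_mul_of_right_mem_of_not_le _ (ι_mem_tensorPiece v) (by simp)
    refine ⟨fun n hn => ?_, ?_⟩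
    · cases n with
      | zero => exact h0
      | succ n => exact h n (by omega)
    · have h3 := h 2 (by omega)
      simp only [Nat.reduceAdd] at h3
      rw [h3]
      exact zero_mem _
  | mul a b ha hb => rw [← mul_assoc]; exact hb (ha hx)
  | add a b ha hb => rw [mul_add]; exact add_mem (ha hx) (hb hx)

/-- The ideal `(R)` lives in degrees at least `3`, and its piece of degree `3` is `R`. -/
theorem mem_truncSubmodule_of_quot_eq_zero {x : TensorAlgebra k V} (hx : quot R x = 0) :
    x ∈ truncSubmodule R := by
  rw [quot_eq_zero_iff] at hx
  let I : TwoSidedIdeal (TensorAlgebra k V) := .mk' (truncSubmodule R) (zero_mem _)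
    (fun hx hy => add_mem hx hy) (fun hx => neg_mem hx)
    (fun hx => mul_mem_truncSubmodule_left _ hx) (fun hx => mul_mem_truncSubmodule_right _ hx)
  have hI : TwoSidedIdeal.span (TensorPower.toTensorAlgebra '' (R : Set (⨂[k]^3 V))) ≤ I := by
    rw [TwoSidedIdeal.span_le]
    rintro _ ⟨f, hf, rfl⟩
    rw [TwoSidedIdeal.coe_mk']
    refine ⟨fun n hn => ?_, ?_⟩
    · exact DirectSum.decompose_of_mem_ne _ (toTensorAlgebra_mem f) hn.ne'
    · rw [DirectSum.decompose_of_mem_same _ (toTensorAlgebra_mem f)]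
      exact ⟨f, hf, rfl⟩
  exact (TwoSidedIdeal.mem_mk' _ _ _ _ _ _ _).1 (hI hx)

theorem quot_toTensorAlgebra_eq_zero_iff {f : ⨂[k]^3 V} :
    quot R (TensorPower.toTensorAlgebra f) = 0 ↔ f ∈ R := by
  constructor
  · intro h
    have h3 := (mem_truncSubmodule_of_quot_eq_zero h).2
    rw [DirectSum.decompose_of_mem_same _ (toTensorAlgebra_mem f)] at h3
    obtain ⟨g, hg, hgf⟩ := h3
    rwa [← toTensorAlgebra_injective hgf]
  · intro h
    exact quot_eq_zero_iff.2 (TwoSidedIdeal.subset_span ⟨f, h, rfl⟩)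

variable (R) in
/-- The map `V → A₁`. -/
def gen : V →ₗ[k] CubicAlgebra R := (quot R).toLinearMap ∘ₗ TensorAlgebra.ι k

theorem gen_mem (v : V) : gen R v ∈ grading R 1 := quot_mem (ι_mem_tensorPiece v)

theorem gen_injective : Function.Injective (gen R) := by
  rw [injective_iff_map_eq_zero]
  intro v hv
  have h := (mem_truncSubmodule_of_quot_eq_zero (x := TensorAlgebra.ι k v) hv).1 1 (by omega)
  rw [DirectSum.decompose_of_mem_same _ (ι_mem_tensorPiece v)] at h
  exact TensorAlgebra.ι_leftInverse.injective (h.trans (map_zero _).symm)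

theorem exists_gen_eq {a : CubicAlgebra R} (ha : a ∈ grading R 1) : ∃ v, gen R v = a := by
  obtain ⟨x, hx, rfl⟩ := ha
  simp only [pow_one] at hx
  obtain ⟨v, rfl⟩ := hx
  exact ⟨v, rfl⟩

theorem quot_toTensorAlgebra_tprod (x : Fin 3 → V) :
    quot R (TensorPower.toTensorAlgebra (PiTensorProduct.tprod k x)) =
      gen R (x 0) * (gen R (x 1) * gen R (x 2)) := by
  rw [toTensorAlgebra_tprod_three, map_mul, map_mul]
  rfl

instance : Nontrivial (CubicAlgebra R) := by
  refine ⟨1, 0, fun h => ?_⟩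
  have h1 := (mem_truncSubmodule_of_quot_eq_zero (R := R) (x := 1) (by rw [map_one, h])).1 0
    (by omega)
  rw [DirectSum.decompose_of_mem_same _ SetLike.GradedOne.one_mem] at h1
  exact one_ne_zero h1

theorem exists_algebraMap_eq {a : CubicAlgebra R} (ha : a ∈ grading R 0) :
    ∃ c : k, a = algebraMap k _ c := by
  obtain ⟨x, hx, rfl⟩ := ha
  simp only [pow_zero] at hx
  obtain ⟨c, rfl⟩ := Submodule.mem_one.1 hx
  exact ⟨c, (quot R).commutes c⟩

instance : SetLike.GradedMonoid (grading R) where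
  one_mem := ⟨1, SetLike.GradedOne.one_mem, map_one (quot R)⟩
  mul_mem := by
    rintro i j _ _ ⟨x, hx, rfl⟩ ⟨y, hy, rfl⟩
    exact ⟨x * y, SetLike.GradedMul.mul_mem hx hy, map_mul (quot R) x y⟩

variable (R) in
/-- The map `T(V) → ⨁ Aₙ` that sends an element to the classes of its components. It kills `(R)`,
and the map induced on `T(V)/(R)` is the decomposition into homogeneous components. -/
def tensorDecompose : TensorAlgebra k V →ₐ[k] DirectSum ℕ fun n => grading R n :=
  TensorAlgebra.lift k
    (DirectSum.lof k ℕ (fun n => grading R n) 1 ∘ₗ (gen R).codRestrict _ gen_mem)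

theorem tensorDecompose_of_mem {n : ℕ} {x : TensorAlgebra k V} (hx : x ∈ tensorPiece k V n) :
    tensorDecompose R x = DirectSum.of (fun n => grading R n) n ⟨quot R x, quot_mem hx⟩ := by
  induction hx using Submodule.pow_induction_on_left' with
  | algebraMap r =>
    rw [AlgHom.commutes, DirectSum.algebraMap_apply]
    congr 1
  | add x y i hx hy ihx ihy =>
    rw [map_add, ihx, ihy, ← map_add]
    congr 1
  | mem_mul m hm i x hx ih =>
    obtain ⟨v, rfl⟩ := hm
    rw [map_mul, ih, tensorDecompose, TensorAlgebra.lift_ι_apply, LinearMap.comp_apply,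
      DirectSum.lof_eq_of, DirectSum.of_mul_of]
    exact DirectSum.of_eq_of_gradedMonoid_eq
      (Sigma.subtype_ext (add_comm _ _) (map_mul (quot R) _ _).symm)

theorem tensorDecompose_eq_zero {x : TensorAlgebra k V} (hx : quot R x = 0) :
    tensorDecompose R x = 0 := by
  rw [quot_eq_zero_iff] at hx
  have h : TwoSidedIdeal.span (TensorPower.toTensorAlgebra '' (R : Set (⨂[k]^3 V))) ≤
      TwoSidedIdeal.ker (tensorDecompose R) := by
    rw [TwoSidedIdeal.span_le]
    rintro _ ⟨f, hf, rfl⟩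
    rw [SetLike.mem_coe, TwoSidedIdeal.mem_ker, tensorDecompose_of_mem (toTensorAlgebra_mem f)]
    have : (⟨_, quot_mem (toTensorAlgebra_mem f)⟩ : grading R 3) = 0 :=
      Subtype.ext (quot_toTensorAlgebra_eq_zero_iff.2 hf)
    rw [this, map_zero]
  exact (TwoSidedIdeal.mem_ker _).1 (h hx)

instance : GradedAlgebra (grading R) :=
  GradedAlgebra.ofAlgHom (grading R)
    (RingCon.liftₐ _ (tensorDecompose R) fun x y hxy => by
      have h : quot R (x - y) = 0 := by
        rw [map_sub, sub_eq_zero]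
        exact (RingCon.eq _).2 hxy
      have h2 := tensorDecompose_eq_zero h
      rw [map_sub, sub_eq_zero] at h2
      exact h2)
    (by
      refine AlgHom.ext fun a => ?_
      obtain ⟨x, rfl⟩ := quot_surjective R a
      have h : (DirectSum.coeAlgHom (grading R)).comp (tensorDecompose R) = quot R := by
        ext v
        simp [tensorDecompose, DirectSum.lof_eq_of]
        rfl
      exact DFunLike.congr_fun h x)
    (by
      rintro n ⟨_, x, hx, rfl⟩
      exact tensorDecompose_of_mem hx)

end CubicAlgebra

end CubicGrading

/-! ### From twists to automorphisms of `V` -/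

section Twist

open CubicAlgebra

variable {k : Type u} [Field k] {V : Type v} [AddCommGroup V] [Module k V]
  [FiniteDimensional k V] {R R' : Submodule k (⨂[k]^3 V)}

/-- The maps `Φₙ : A₁ → A'₁` of a twist are linear automorphisms `θₙ` of `V`. As `R` is the kernel
of `V^{⊗3} → A₃`, the map `θₙ ⊗ θₙ₊₁ ⊗ θₙ₊₂` matches `R` with `R'`. -/
theorem exists_linearEquiv_of_isTwist {Φ : ℤ → ∀ d, grading R d →ₗ[k] grading R' d}
    (hΦ : GrMod.IsTwist Φ) :
    ∃ θ : ℤ → V ≃ₗ[k] V, (∀ n v, gen R' (θ n v) = Φ n 1 ⟨gen R v, gen_mem v⟩) ∧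
      ∀ n f, f ∈ R ↔ PiTensorProduct.map (fun i =>
        ((![θ n, θ (n + 1), θ (n + 1 + 1)] : Fin 3 → V ≃ₗ[k] V) i).toLinearMap) f ∈ R' := by
  have hex : ∀ n : ℤ, ∃ θ : V ≃ₗ[k] V, ∀ v, gen R' (θ v) = Φ n 1 ⟨gen R v, gen_mem v⟩ := by
    intro n
    choose t ht using fun v : V => exists_gen_eq (Φ n 1 ⟨gen R v, gen_mem v⟩).2
    let T : V →ₗ[k] V :=
      { toFun := t
        map_add' := fun v w => gen_injective (R := R') <| by
          rw [map_add, ht, ht, ht, ← Submodule.coe_add, ← map_add]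
          congr 2
          exact Subtype.ext (map_add _ _ _)
        map_smul' := fun c v => gen_injective (R := R') <| by
          rw [map_smul, ht, ht, RingHom.id_apply, ← Submodule.coe_smul, ← map_smul]
          congr 2
          exact Subtype.ext (map_smul _ _ _) }
    have hT : Function.Injective T := fun v w hvw => by
      have h : Φ n 1 ⟨gen R v, gen_mem v⟩ = Φ n 1 ⟨gen R w, gen_mem w⟩ :=
        Subtype.ext (by rw [← ht, ← ht]; exact congrArg _ hvw)
      exact gen_injective (congrArg Subtype.val (hΦ.injective n 1 h))
    exact ⟨LinearEquiv.ofInjectiveEndo T hT, ht⟩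
  choose θ hθ using hex
  refine ⟨θ, hθ, fun n f => ?_⟩
  let μ : (⨂[k]^3 V) →ₗ[k] grading R 3 :=
    ((quot R).toLinearMap ∘ₗ TensorPower.toTensorAlgebra).codRestrict _ fun f =>
      quot_mem (toTensorAlgebra_mem f)
  have hcomp : ((grading R' 3).subtype ∘ₗ Φ n 3) ∘ₗ μ =
      ((quot R').toLinearMap ∘ₗ TensorPower.toTensorAlgebra) ∘ₗ PiTensorProduct.map (fun i =>
        ((![θ n, θ (n + 1), θ (n + 1 + 1)] : Fin 3 → V ≃ₗ[k] V) i).toLinearMap) := by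
    apply PiTensorProduct.ext
    ext x
    have h1 := hΦ.map_mul n 1 (1 + 1) ⟨gen R (x 0), gen_mem _⟩
      ⟨gen R (x 1) * gen R (x 2), SetLike.GradedMul.mul_mem (gen_mem _) (gen_mem _)⟩
    have h2 := hΦ.map_mul (n + 1) 1 1 ⟨gen R (x 1), gen_mem _⟩ ⟨gen R (x 2), gen_mem _⟩
    rw [Nat.cast_one] at h1 h2
    rw [h2, ← hθ, ← hθ, ← hθ] at h1
    have hμ : μ (PiTensorProduct.tprod k x) = ⟨gen R (x 0) * (gen R (x 1) * gen R (x 2)),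
        SetLike.GradedMul.mul_mem (gen_mem _) (SetLike.GradedMul.mul_mem (gen_mem _)
          (gen_mem _))⟩ := Subtype.ext (quot_toTensorAlgebra_tprod x)
    simp only [LinearMap.compMultilinearMap_apply, LinearMap.comp_apply, PiTensorProduct.map_tprod,
      AlgHom.toLinearMap_apply, quot_toTensorAlgebra_tprod]
    rw [hμ]
    exact h1
  have hf := LinearMap.congr_fun hcomp f
  rw [← quot_toTensorAlgebra_eq_zero_iff (R := R), ← quot_toTensorAlgebra_eq_zero_iff (R := R')]
  change (Φ n 3 (μ f) : CubicAlgebra R') = quot R' (TensorPower.toTensorAlgebra _) at hf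
  rw [← hf, Submodule.coe_eq_zero, map_eq_zero_iff _ (hΦ.injective n 3), ← Submodule.coe_eq_zero]
  rfl

end Twist

end

theorem theorem3p5 {k : Type u} [Field k] [IsAlgClosed k] [CharZero k]
    {V : Type v} [AddCommGroup V] [Module k V] [FiniteDimensional k V]
    (R R' : Submodule k (⨂[k]^3 V)) (hR : SatisfiesG1 R) (hR' : SatisfiesG1 R') :
    (GradedAlgIsomorphic (CubicAlgebra.grading R) (CubicAlgebra.grading R') →
      ∃ (τ : ProjAut k (Module.Dual k V)) (e : VarietyIso (pointVariety R) (pointVariety R')),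
        (∀ p, (e.toEquiv p).1 = ProjAut.prodMap τ τ p.1) ∧
        (∀ p, e.toEquiv (pointAut hR p) = pointAut hR' (e.toEquiv p))) ∧
    (GradedMoritaEquivalent (CubicAlgebra.grading R) (CubicAlgebra.grading R') →
      ∃ (τ : ℤ → ProjAut k (Module.Dual k V))
        (e : ℤ → VarietyIso (pointVariety R) (pointVariety R')),
        (∀ n p, ((e n).toEquiv p).1 = ProjAut.prodMap (τ n) (τ (n + 1)) p.1) ∧
        (∀ n p, (e (n + 1)).toEquiv (pointAut hR p) = pointAut hR' ((e n).toEquiv p))) := by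
  constructor
  · rintro ⟨φ, hφ⟩
    -- A graded isomorphism is a twist whose maps do not depend on `n`.
    let Φ : ℤ → ∀ d, CubicAlgebra.grading R d →ₗ[k] CubicAlgebra.grading R' d := fun _ d =>
      φ.toLinearMap.restrict fun a ha => hφ d ▸ Submodule.mem_map_of_mem ha
    have hΦ : GrMod.IsTwist Φ :=
      ⟨fun n d a b hab => Subtype.ext (φ.injective (congrArg Subtype.val hab)),
        fun n d e a b => map_mul φ a.1 b.1⟩
    obtain ⟨θ, hθ, hmap⟩ := exists_linearEquiv_of_isTwist hΦ
    have hconst : ∀ n, θ n = θ 0 := fun n => LinearEquiv.ext fun v =>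
      CubicAlgebra.gen_injective ((hθ n v).trans (hθ 0 v).symm)
    obtain ⟨e, he, hσ⟩ := exists_varietyIso_of_map hR hR' (fun _ => θ 0) fun n f => by
      simpa only [hconst] using hmap n f
    refine ⟨dualAut (θ 0), e 0, he 0, fun p => ?_⟩
    rw [← hσ 0]
    exact Subtype.ext ((he 0 _).trans (he (0 + 1) _).symm)
  · rintro ⟨F, hF, hF'⟩
    by_cases hV : Subsingleton V
    -- If `V = 0`, both relation spaces are zero and the identity of `V` matches them.
    · have hV3 : Subsingleton (⨂[k]^3 V) := by
        refine subsingleton_of_forall_eq 0 fun f => ?_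
        induction f using PiTensorProduct.induction_on with
        | smul_tprod r x =>
          rw [(PiTensorProduct.tprod k).map_coord_zero 0 (Subsingleton.elim _ _), smul_zero]
        | add x y hx hy => rw [hx, hy, add_zero]
      obtain ⟨e, he, hσ⟩ := exists_varietyIso_of_map hR hR' (fun _ => LinearEquiv.refl k V)
        fun n f => by
          rw [Subsingleton.elim (PiTensorProduct.map _ f) 0, Subsingleton.elim f 0]
          simp
      exact ⟨fun _ => dualAut (LinearEquiv.refl k V), e, he, hσ⟩
    · rw [not_subsingleton_iff_nontrivial] at hV
      obtain ⟨v, hv⟩ := exists_ne (0 : V)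
      have h1 : CubicAlgebra.grading R 1 ≠ ⊥ := fun h =>
        hv <| CubicAlgebra.gen_injective (R := R) <| by
        have := CubicAlgebra.gen_mem (R := R) v
        rw [h, Submodule.mem_bot] at this
        rw [this, map_zero]
      obtain ⟨Φ, hΦ⟩ := GrMod.exists_isTwist (fun _ => CubicAlgebra.exists_algebraMap_eq)
        (fun _ => CubicAlgebra.exists_algebraMap_eq) h1 F
      obtain ⟨θ, -, hmap⟩ := exists_linearEquiv_of_isTwist hΦ
      obtain ⟨e, he, hσ⟩ := exists_varietyIso_of_map hR hR' θ hmap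
      exact ⟨fun n => dualAut (θ n), e, he, hσ⟩
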